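/- Let $q\in\mathbb{C}$ with $0<|q|<1$. For $a\in\mathbb{C}$ and $n\in\mathbb{Z}$ let $(a)_n=(1-a)(1-aq)\cdots(1-aq^{n-1})$ if $n\ge 0$, and $(a)_n=\left[(1-aq^{-1})(1-aq^{-2})\cdots(1-aq^{n})\right]^{-1}$ if $n<0$, where $1/(a)_n$ is read as $0$ if $n<0$ and one of these factors vanishes. Let $(a)_\infty=\lim_{n\to\infty}(a)_n$ and $(a_1,\ldots,a_m)_n=(a_1)_n\cdots(a_m)_n$ for $n\in\mathbb{Z}\cup\{\infty\}$. Let $b,c,d,e$ be nonzero complex numbers such that no factor of a denominator $(b)_k,(c)_k,(d/q)_k,(e/q)_k$ with $k\ge 0$ vanishes, that is, $b,c\notin\{q^{-j}: j\ge 0\}$ and $d,e\notin\{q^{1-j}: j\ge 0\}$. If $|bc|<|q|$, then $$\sum_{k=-\infty}^\infty\frac{(q/b,q/c,q/d,q/e)_k}{(b,c,d/q,e/q)_k}(-bcde)^k q^{(k^2-5k)/2}=\frac{(q,bc/q)_\infty}{(b,c)_\infty}\sum_{k=0}^\infty\frac{(q/b,q/c,de/q^2)_k}{(q,d,e)_k}\left(\frac{bc}{q}\right)^k,$$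 and if $|bc|<1$, then $$\sum_{k=-\infty}^\infty\frac{(q/b,q/c,q/d,q/e)_k}{(b,c,d/q,e/q)_k}(-bcde)^k q^{(k^2-7k)/2}=\frac{(q,bc/q)_\infty}{(b,c)_\infty}\sum_{k=0}^\infty\frac{(q/b,q/c,de/q^2)_k}{(q,d,e)_k}(bc)^k,$$ where all the series converge absolutely. -/

import Mathlib

open Filter Topology

/-- The `q`-shifted factorial `(a)_n = (a;q)_n` for an arbitrary integer `n`:
`(1-a)(1-aq)⋯(1-aq^{n-1})` for `n ≥ 0`, and
`[(1-aq^{-1})(1-aq^{-2})⋯(1-aq^{n})]^{-1}` for `n < 0`.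
When a factor of the latter product vanishes, the value `0⁻¹ = 0` makes `1/(a)_n` equal to `0`,
which is the usual convention (for instance `1/(q)_n = 0` for `n < 0`). -/
noncomputable def qPoch (q a : ℂ) : ℤ → ℂ
  | Int.ofNat n => ∏ i ∈ Finset.range n, (1 - a * q ^ i)
  | Int.negSucc n => (∏ i ∈ Finset.range (n + 1), (1 - a * (q ^ (i + 1))⁻¹))⁻¹

/-- The infinite `q`-shifted factorial `(a)_∞ = (1-a)(1-aq)(1-aq²)⋯`. -/
noncomputable def qPochInf (q a : ℂ) : ℂ := ∏' i : ℕ, (1 - a * q ^ i)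

/-- `(a)_∞` is the limit of `(a)_n` as `n → ∞`. -/
theorem tendsto_qPoch_qPochInf (q a : ℂ) (hq : ‖q‖ < 1) :
    Tendsto (fun n : ℕ => qPoch q a (n : ℤ)) atTop (𝓝 (qPochInf q a)) := by
  have hs : Summable (fun i : ℕ => ‖-(a * q ^ i)‖) := by
    simpa [norm_mul, norm_pow] using
      (summable_geometric_of_lt_one (norm_nonneg q) hq).mul_left ‖a‖
  have hm : Multipliable (fun i : ℕ => 1 - a * q ^ i) := by
    simpa [sub_eq_add_neg] using multipliable_one_add_of_summable hs
  exact hm.hasProd.tendsto_prod_nat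

/-! Fold the bilateral series by pairing `k = -n` with `k = n + 1`. Both terms contain the same
factor `baileyCoeff q d e n`, and what remains is a difference of two consecutive values of
`wellPoised`. This difference depends only on `b, c`. By the `q`-Gauss sum (`hasSum_gaussTerm`) it
equals `gaussFactor q b c` times `(1 - q^(2n+1)) ∑_j (q/b, q/c)_j w^j / ((q)_{j-n} (q)_{j+n+1})`.
Exchanging the sums over `n` and `j` (`bailey_transform`) leaves a finite inner sum over `n ≤ j`
that depends only on `d, e`. `sum_unit_bailey` evaluates it as `(de/q^2)_j / (q, d, e)_j`, which
gives the unilateral series. The two formulas are the cases `(w, u) = (bc/q, 1)` and `(bc, q⁻¹)` of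
`bilateral_identity`, where `u^k` is an extra weight on the bilateral term. -/

/-! ### Finite and infinite `q`-shifted factorials. -/

/-- The finite `q`-shifted factorial `(a)_n` with a natural number `n` of factors. -/
noncomputable def qFin (q a : ℂ) (n : ℕ) : ℂ := ∏ i ∈ Finset.range n, (1 - a * q ^ i)

theorem qPoch_natCast (q a : ℂ) (n : ℕ) : qPoch q a (n : ℤ) = qFin q a n := rfl

@[simp] theorem qFin_zero (q a : ℂ) : qFin q a 0 = 1 := by simp [qFin]

theorem qFin_succ (q a : ℂ) (n : ℕ) : qFin q a (n + 1) = qFin q a n * (1 - a * q ^ n) := by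
  simp [qFin, Finset.prod_range_succ]

theorem qFin_succ' (q a : ℂ) (n : ℕ) : qFin q a (n + 1) = (1 - a) * qFin q (a * q) n := by
  simp only [qFin, Finset.prod_range_succ', pow_zero, mul_one, mul_comm (1 - a)]
  congr 1
  exact Finset.prod_congr rfl fun i _ => by ring

theorem qFin_add (q a : ℂ) (n m : ℕ) :
    qFin q a (n + m) = qFin q a n * qFin q (a * q ^ n) m := by
  simp only [qFin, Finset.prod_range_add]
  congr 1
  exact Finset.prod_congr rfl fun i _ => by ring

theorem qFin_ne_zero {q a : ℂ} (h : ∀ i : ℕ, a * q ^ i ≠ 1) (n : ℕ) : qFin q a n ≠ 0 :=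
  Finset.prod_ne_zero_iff.2 fun i _ => sub_ne_zero.2 (h i).symm

theorem tendsto_qFin {q : ℂ} (hq : ‖q‖ < 1) (a : ℂ) :
    Tendsto (qFin q a) atTop (𝓝 (qPochInf q a)) :=
  tendsto_qPoch_qPochInf q a hq

theorem qPochInf_ne_zero {q a : ℂ} (hq : ‖q‖ < 1) (h : ∀ i : ℕ, a * q ^ i ≠ 1) :
    qPochInf q a ≠ 0 := by
  have hs : Summable (fun i : ℕ => ‖-(a * q ^ i)‖) := by
    simpa [norm_mul, norm_pow] using
      (summable_geometric_of_lt_one (norm_nonneg q) hq).mul_left ‖a‖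
  have := tprod_one_add_ne_zero_of_summable (f := fun i : ℕ => -(a * q ^ i))
    (fun i => by simpa [← sub_eq_add_neg] using sub_ne_zero.2 (h i).symm) hs
  simpa [qPochInf, ← sub_eq_add_neg] using this

theorem qPochInf_eq_mul {q : ℂ} (hq : ‖q‖ < 1) (a : ℂ) (n : ℕ) :
    qPochInf q a = qFin q a n * qPochInf q (a * q ^ n) := by
  refine tendsto_nhds_unique ((tendsto_qFin hq a).comp (tendsto_add_atTop_nat n)) ?_
  refine ((tendsto_qFin hq (a * q ^ n)).const_mul (qFin q a n)).congr fun m => ?_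
  rw [Function.comp_apply, add_comm, qFin_add]

theorem exists_norm_le_of_tendsto {f : ℕ → ℂ} {l : ℂ} (h : Tendsto f atTop (𝓝 l)) :
    ∃ C, 0 ≤ C ∧ ∀ n, ‖f n‖ ≤ C := by
  obtain ⟨C, hC⟩ := (Metric.isBounded_range_of_tendsto f h).exists_norm_le
  exact ⟨C, (norm_nonneg _).trans (hC (f 0) ⟨0, rfl⟩), fun n => hC _ ⟨n, rfl⟩⟩

theorem exists_norm_qFin_le {q : ℂ} (hq : ‖q‖ < 1) (a : ℂ) :
    ∃ C, 0 ≤ C ∧ ∀ n, ‖qFin q a n‖ ≤ C :=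
  exists_norm_le_of_tendsto (tendsto_qFin hq a)

theorem exists_norm_inv_qFin_le {q a : ℂ} (hq : ‖q‖ < 1) (h : ∀ i : ℕ, a * q ^ i ≠ 1) :
    ∃ C, 0 ≤ C ∧ ∀ n, ‖(qFin q a n)⁻¹‖ ≤ C :=
  exists_norm_le_of_tendsto ((tendsto_qFin hq a).inv₀ (qPochInf_ne_zero hq h))

theorem mul_pow_ne_one_of_norm_lt {q z : ℂ} (hq : ‖q‖ < 1) (hz : ‖z‖ < 1) (i : ℕ) :
    z * q ^ i ≠ 1 := by
  intro h
  have h1 : ‖z * q ^ i‖ < 1 := by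
    rw [norm_mul, norm_pow]
    exact mul_lt_one_of_nonneg_of_lt_one_left (norm_nonneg _) hz
      (pow_le_one₀ (norm_nonneg _) hq.le)
  rw [h, norm_one] at h1
  exact lt_irrefl _ h1

/-! ### The `q`-Gauss sum. -/

/-- The general term of the series `₂φ₁(A, B; ABz; z)`. -/
noncomputable def gaussTerm (q A B z : ℂ) (j : ℕ) : ℂ :=
  qFin q A j * qFin q B j / (qFin q q j * qFin q (A * B * z) j) * z ^ j

/-- The bound is uniform in `n` although the denominator parameter moves with `n`, because
`1/(ABzq^n)_j = (ABz)_n / (ABz)_{n+j}`. This supplies the dominating series for the limit `n → ∞`.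
-/
theorem exists_norm_gaussTerm_le {q : ℂ} (hq : ‖q‖ < 1) (A B z : ℂ)
    (h : ∀ i : ℕ, A * B * z * q ^ i ≠ 1) :
    ∃ K, 0 ≤ K ∧ ∀ n j : ℕ, ‖gaussTerm q A B (z * q ^ n) j‖ ≤ K * ‖z * q ^ n‖ ^ j := by
  obtain ⟨C1, h1, H1⟩ := exists_norm_qFin_le hq A
  obtain ⟨C2, h2, H2⟩ := exists_norm_qFin_le hq B
  obtain ⟨C3, h3, H3⟩ := exists_norm_inv_qFin_le hq (mul_pow_ne_one_of_norm_lt hq hq)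
  obtain ⟨C4, h4, H4⟩ := exists_norm_qFin_le hq (A * B * z)
  obtain ⟨C5, h5, H5⟩ := exists_norm_inv_qFin_le hq h
  refine ⟨C1 * C2 * C3 * (C4 * C5), by positivity, fun n j => ?_⟩
  have key : (qFin q (A * B * (z * q ^ n)) j)⁻¹ =
      qFin q (A * B * z) n * (qFin q (A * B * z) (n + j))⁻¹ := by
    have := qFin_ne_zero h n
    rw [qFin_add, mul_inv, mul_inv_cancel_left₀ this]
    ring_nf
  have : gaussTerm q A B (z * q ^ n) j = qFin q A j * qFin q B j * (qFin q q j)⁻¹ *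
      (qFin q (A * B * z) n * (qFin q (A * B * z) (n + j))⁻¹) * (z * q ^ n) ^ j := by
    rw [gaussTerm, ← key]; ring
  rw [this]
  simp only [norm_mul _ ((z * q ^ n) ^ j), norm_pow _ j]
  refine mul_le_mul_of_nonneg_right ?_ (by positivity)
  simp only [norm_mul]
  gcongr
  exacts [H1 j, H2 j, H3 j, H4 n, H5 _]

theorem summable_gaussTerm {q : ℂ} (hq : ‖q‖ < 1) {A B z : ℂ} (hz : ‖z‖ < 1)
    (h : ∀ i : ℕ, A * B * z * q ^ i ≠ 1) : Summable (gaussTerm q A B z) := by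
  obtain ⟨K, -, hK⟩ := exists_norm_gaussTerm_le hq A B z h
  refine Summable.of_norm_bounded
    ((summable_geometric_of_lt_one (norm_nonneg z) hz).mul_left K) fun j => ?_
  simpa using hK 0 j

/-- A contiguous relation under `z ↦ zq`, in telescoping form. The boundary term `(1 - q^j) *
gaussTerm q A B z j` vanishes at `j = 0` and tends to `0`, so summation over `j` leaves a two-term
relation. -/
theorem gaussTerm_telescope {q : ℂ} (hq : ‖q‖ < 1) {A B z : ℂ}
    (h : ∀ i : ℕ, A * B * z * q ^ i ≠ 1) (j : ℕ) :
    (1 - A * B * z) * (1 - z) * gaussTerm q A B z j -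
      (1 - A * z) * (1 - B * z) * gaussTerm q A B (z * q) j =
    (1 - A * B * z) * ((1 - q ^ j) * gaussTerm q A B z j -
      (1 - q ^ (j + 1)) * gaussTerm q A B z (j + 1)) := by
  have h0 : 1 - A * B * z ≠ 0 := by simpa using sub_ne_zero.2 (h 0).symm
  have hj : 1 - A * B * z * q ^ j ≠ 0 := sub_ne_zero.2 (h j).symm
  have hC := qFin_ne_zero h j
  have hQ := qFin_ne_zero (mul_pow_ne_one_of_norm_lt hq hq) j
  have hqj : 1 - q * q ^ j ≠ 0 := sub_ne_zero.2 (mul_pow_ne_one_of_norm_lt hq hq j).symm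
  have hs : qFin q (A * B * (z * q)) j =
      qFin q (A * B * z) j * (1 - A * B * z * q ^ j) / (1 - A * B * z) := by
    rw [eq_div_iff h0, ← qFin_succ, qFin_succ', ← mul_assoc (A * B) z q]; ring
  simp only [gaussTerm, hs, qFin_succ, mul_pow, pow_succ]
  rw [mul_comm q] at hqj
  rw [mul_comm q]
  generalize q ^ j = x at *
  field_simp
  ring

theorem tendsto_mul_gaussTerm_zero {q : ℂ} (hq : ‖q‖ < 1) {A B z : ℂ} (hz : ‖z‖ < 1)
    (h : ∀ i : ℕ, A * B * z * q ^ i ≠ 1) :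
    Tendsto (fun j : ℕ => (1 - q ^ j) * gaussTerm q A B z j) atTop (𝓝 0) := by
  have h1 : Tendsto (fun j : ℕ => 1 - q ^ j) atTop (𝓝 (1 - 0)) :=
    (tendsto_pow_atTop_nhds_zero_of_norm_lt_one hq).const_sub 1
  simpa using h1.mul (summable_gaussTerm hq hz h).tendsto_atTop_zero

theorem norm_mul_pow_lt_one {q z : ℂ} (hq : ‖q‖ < 1) (hz : ‖z‖ < 1) (n : ℕ) :
    ‖z * q ^ n‖ < 1 := by
  rw [norm_mul, norm_pow]
  exact mul_lt_one_of_nonneg_of_lt_one_left (norm_nonneg _) hz (pow_le_one₀ (norm_nonneg _) hq.le)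

theorem tsum_gaussTerm_step {q : ℂ} (hq : ‖q‖ < 1) {A B z : ℂ} (hz : ‖z‖ < 1)
    (h : ∀ i : ℕ, A * B * z * q ^ i ≠ 1) :
    (1 - A * B * z) * (1 - z) * ∑' j, gaussTerm q A B z j =
      (1 - A * z) * (1 - B * z) * ∑' j, gaussTerm q A B (z * q) j := by
  have hz' : ‖z * q‖ < 1 := by simpa using norm_mul_pow_lt_one hq hz 1
  have h' : ∀ i : ℕ, A * B * (z * q) * q ^ i ≠ 1 := fun i => by
    have := h (i + 1)
    rwa [pow_succ', ← mul_assoc, mul_assoc (A * B)] at this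
  have s1 := (summable_gaussTerm hq hz h).hasSum.mul_left ((1 - A * B * z) * (1 - z))
  have s2 := (summable_gaussTerm hq hz' h').hasSum.mul_left ((1 - A * z) * (1 - B * z))
  have s3 := (s1.sub s2).tendsto_sum_nat
  have s4 : Tendsto (fun n : ℕ => (1 - A * B * z) * (0 - (1 - q ^ n) * gaussTerm q A B z n))
      atTop (𝓝 ((1 - A * B * z) * (0 - 0))) :=
    ((tendsto_mul_gaussTerm_zero hq hz h).const_sub 0).const_mul _
  have := tendsto_nhds_unique s3 (s4.congr fun n => ?_)
  · rw [← sub_eq_zero, this]; ring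
  · simp only [gaussTerm_telescope hq h, ← Finset.mul_sum]
    rw [Finset.sum_range_sub' (fun j => (1 - q ^ j) * gaussTerm q A B z j)]
    simp

theorem tsum_gaussTerm_iterate {q : ℂ} (hq : ‖q‖ < 1) {A B z : ℂ} (hz : ‖z‖ < 1)
    (h : ∀ i : ℕ, A * B * z * q ^ i ≠ 1) (n : ℕ) :
    qFin q (A * B * z) n * qFin q z n * ∑' j, gaussTerm q A B z j =
      qFin q (A * z) n * qFin q (B * z) n * ∑' j, gaussTerm q A B (z * q ^ n) j := by
  induction n with
  | zero => simp
  | succ n ih =>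
    have h' : ∀ i : ℕ, A * B * (z * q ^ n) * q ^ i ≠ 1 := fun i => by
      have := h (n + i)
      rwa [pow_add, ← mul_assoc, mul_assoc (A * B)] at this
    have := tsum_gaussTerm_step hq (norm_mul_pow_lt_one hq hz n) h'
    simp only [qFin_succ]
    rw [pow_succ, ← mul_assoc z]
    linear_combination (1 - A * B * z * q ^ n) * (1 - z * q ^ n) * ih +
      qFin q (A * z) n * qFin q (B * z) n * this

/-- As `zq^n → 0` only the term `j = 0` survives, by dominated convergence. -/
theorem tendsto_tsum_gaussTerm {q : ℂ} (hq : ‖q‖ < 1) {A B z : ℂ} (hz : ‖z‖ < 1)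
    (h : ∀ i : ℕ, A * B * z * q ^ i ≠ 1) :
    Tendsto (fun n : ℕ => ∑' j, gaussTerm q A B (z * q ^ n) j) atTop (𝓝 1) := by
  obtain ⟨K, hK0, hK⟩ := exists_norm_gaussTerm_le hq A B z h
  have h1 : (1 : ℂ) = ∑' j : ℕ, if j = 0 then 1 else 0 := by simp
  rw [h1]
  refine tendsto_tsum_of_dominated_convergence
    ((summable_geometric_of_lt_one (norm_nonneg z) hz).mul_left K) (fun j => ?_)
    (Eventually.of_forall fun n j => (hK n j).trans ?_)
  · rcases eq_or_ne j 0 with rfl | hj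
    · simp [gaussTerm]
    · simp only [hj, if_false]
      refine squeeze_zero_norm (fun n => hK n j) ?_
      have : Tendsto (fun n : ℕ => ‖z * q ^ n‖) atTop (𝓝 0) := by
        simpa using ((tendsto_pow_atTop_nhds_zero_of_norm_lt_one hq).const_mul z).norm
      simpa [hj] using (this.pow j).const_mul K
  · gcongr
    rw [norm_mul, norm_pow]
    exact mul_le_of_le_one_right (norm_nonneg _) (pow_le_one₀ (norm_nonneg _) hq.le)

/-- The `q`-Gauss sum, in the form `₂φ₁(A, B; ABz; z) = (Az, Bz)_∞ / (ABz, z)_∞`. -/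
theorem hasSum_gaussTerm {q : ℂ} (hq : ‖q‖ < 1) {A B z : ℂ} (hz : ‖z‖ < 1)
    (h : ∀ i : ℕ, A * B * z * q ^ i ≠ 1) :
    HasSum (gaussTerm q A B z) (qPochInf q (A * z) * qPochInf q (B * z) /
      (qPochInf q (A * B * z) * qPochInf q z)) := by
  have hne : qPochInf q (A * B * z) * qPochInf q z ≠ 0 := mul_ne_zero (qPochInf_ne_zero hq h)
    (qPochInf_ne_zero hq (mul_pow_ne_one_of_norm_lt hq hz))
  have key := tendsto_nhds_unique
    ((((tendsto_qFin hq (A * B * z)).mul (tendsto_qFin hq z)).mul_const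
      (∑' j, gaussTerm q A B z j)).congr (tsum_gaussTerm_iterate hq hz h))
    (((tendsto_qFin hq (A * z)).mul (tendsto_qFin hq (B * z))).mul
      (tendsto_tsum_gaussTerm hq hz h))
  rw [mul_one, mul_comm, ← eq_div_iff hne] at key
  rw [← key]
  exact (summable_gaussTerm hq hz h).hasSum

/-! ### Reciprocal `q`-factorials at integers and the conjugate Bailey pair. -/

/-- The reciprocal `1 / (q)_n`, which vanishes for `n < 0`. -/
noncomputable def invQFac (q : ℂ) (n : ℤ) : ℂ := (qPoch q q n)⁻¹

theorem invQFac_natCast (q : ℂ) (n : ℕ) : invQFac q n = (qFin q q n)⁻¹ := rfl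

theorem invQFac_of_neg {q : ℂ} (hq : q ≠ 0) {n : ℤ} (hn : n < 0) : invQFac q n = 0 := by
  obtain ⟨m, rfl⟩ := Int.eq_negSucc_of_lt_zero hn
  rw [invQFac, qPoch, inv_inv]
  exact Finset.prod_eq_zero (Finset.mem_range.2 m.succ_pos) (by simp [hq])

/-- Valid at every integer: at `n = 0` the factor `1 - q^0` matches the vanishing of `1/(q)_{-1}`.
-/
theorem invQFac_sub_one {q : ℂ} (hq : q ≠ 0) (hq1 : ‖q‖ < 1) (n : ℤ) :
    invQFac q (n - 1) = (1 - q ^ n) * invQFac q n := by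
  rcases lt_trichotomy n 0 with hn | rfl | hn
  · rw [invQFac_of_neg hq hn, invQFac_of_neg hq (by omega), mul_zero]
  · rw [invQFac_of_neg hq (by omega)]; simp
  · obtain ⟨m, rfl⟩ : ∃ m : ℕ, n = (m + 1 : ℕ) := ⟨(n - 1).toNat, by omega⟩
    rw [show ((m + 1 : ℕ) : ℤ) - 1 = (m : ℕ) by push_cast; ring, invQFac_natCast, invQFac_natCast,
      qFin_succ, zpow_natCast, pow_succ']
    have := sub_ne_zero.2 (mul_pow_ne_one_of_norm_lt hq1 hq1 m).symm
    rw [mul_inv, mul_comm (1 - _), mul_assoc, inv_mul_cancel₀ this, mul_one]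

theorem exists_norm_invQFac_le {q : ℂ} (hq : q ≠ 0) (hq1 : ‖q‖ < 1) :
    ∃ C, 0 ≤ C ∧ ∀ n : ℤ, ‖invQFac q n‖ ≤ C := by
  obtain ⟨C, h0, hC⟩ := exists_norm_inv_qFin_le hq1 (mul_pow_ne_one_of_norm_lt hq1 hq1)
  refine ⟨C, h0, fun n => ?_⟩
  rcases lt_or_ge n 0 with hn | hn
  · rwa [invQFac_of_neg hq hn, norm_zero]
  · lift n to ℕ using hn
    exact hC n

/-- The conjugate Bailey pair that the `q`-Gauss sum provides. -/
theorem hasSum_conjugate_bailey {q b c : ℂ} (hq : q ≠ 0) (hq1 : ‖q‖ < 1) (hb : b ≠ 0)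
    (hc : c ≠ 0) (s n : ℕ) (hw : ‖b * c * q ^ s / q‖ < 1) :
    HasSum (fun j : ℕ => qFin q (q / b) j * qFin q (q / c) j * (b * c * q ^ s / q) ^ j *
        (invQFac q (j - n) * invQFac q (j + n + s)))
      (qFin q (q / b) n * qFin q (q / c) n * (b * c * q ^ s / q) ^ n *
        (qPochInf q (b * q ^ (n + s)) * qPochInf q (c * q ^ (n + s)) /
          (qPochInf q q * qPochInf q (b * c * q ^ s / q)))) := by
  set w := b * c * q ^ s / q with hwdef
  have hAB : q / b * q ^ n * (q / c * q ^ n) * w = q * q ^ (2 * n + s) := by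
    rw [hwdef, pow_add, two_mul, pow_add]; field_simp
  have hA : q / b * q ^ n * w = c * q ^ (n + s) := by
    rw [hwdef, pow_add]; field_simp
  have hB : q / c * q ^ n * w = b * q ^ (n + s) := by
    rw [hwdef, pow_add]; field_simp
  have hne := mul_pow_ne_one_of_norm_lt hq1 hq1
  have hg := hasSum_gaussTerm hq1 (A := q / b * q ^ n) (B := q / c * q ^ n) hw (fun i => by
    rw [hAB, mul_assoc, ← pow_add]; exact hne _)
  rw [hAB, hA, hB] at hg
  have hN := qFin_ne_zero hne (2 * n + s)
  have hI := qPochInf_eq_mul hq1 q (2 * n + s)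
  -- Terms with `j < n` vanish. Setting `j = n + i` gives a `q`-Gauss series in `i` with upper
  -- parameters `q^(n+1)/b`, `q^(n+1)/c` and lower parameter `q^(2n+s+1)`.
  rw [← (add_right_injective n).hasSum_iff]
  · have hval : qFin q (q / b) n * qFin q (q / c) n * w ^ n * (qFin q q (2 * n + s))⁻¹ *
        (qPochInf q (c * q ^ (n + s)) * qPochInf q (b * q ^ (n + s)) /
          (qPochInf q (q * q ^ (2 * n + s)) * qPochInf q w)) =
        qFin q (q / b) n * qFin q (q / c) n * w ^ n *
        (qPochInf q (b * q ^ (n + s)) * qPochInf q (c * q ^ (n + s)) /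
          (qPochInf q q * qPochInf q w)) := by
      rw [hI]
      simp only [div_eq_mul_inv, mul_inv]
      ring
    rw [← hval]
    refine (hg.mul_left _).congr_fun fun i => ?_
    · have e1 : ((n + i : ℕ) : ℤ) - n = (i : ℕ) := by push_cast; ring
      have e2 : ((n + i : ℕ) : ℤ) + n + s = ((2 * n + s + i : ℕ) : ℤ) := by push_cast; ring
      simp only [Function.comp_apply]
      rw [e1, e2, invQFac_natCast, invQFac_natCast, gaussTerm, hAB, qFin_add, qFin_add q (q / c),
        qFin_add q q, pow_add]
      simp only [div_eq_mul_inv, mul_inv]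
      ring
  · intro j hj
    have : j < n := by
      by_contra! h
      exact hj ⟨j - n, by simp; omega⟩
    rw [invQFac_of_neg hq (by omega)]; simp

/-! ### The terminating very-well-poised sum. -/

/-- The coefficients of the unit Bailey pair relative to `a = q`. -/
noncomputable def baileyCoeff (q d e : ℂ) (n : ℕ) : ℂ :=
  qFin q (q ^ 2 / d) n * qFin q (q ^ 2 / e) n / (qFin q d n * qFin q e n) *
    (-(d * e) / q ^ 2) ^ n * q ^ n.choose 2

theorem baileyCoeff_succ {q d e : ℂ} (hq : q ≠ 0) (hd0 : d ≠ 0) (he0 : e ≠ 0)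
    (hd : ∀ i : ℕ, d * q ^ i ≠ 1) (he : ∀ i : ℕ, e * q ^ i ≠ 1) (n : ℕ) :
    (1 - d * q ^ n) * (1 - e * q ^ n) * baileyCoeff q d e (n + 1) =
      -((d - q ^ 2 * q ^ n) * (e - q ^ 2 * q ^ n)) * q ^ n / q ^ 2 * baileyCoeff q d e n := by
  have h1 := qFin_ne_zero hd n
  have h2 := qFin_ne_zero he n
  have h3 : 1 - d * q ^ n ≠ 0 := sub_ne_zero.2 (hd n).symm
  have h4 : 1 - e * q ^ n ≠ 0 := sub_ne_zero.2 (he n).symm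
  simp only [baileyCoeff, qFin_succ, Nat.choose_succ_succ n 1, Nat.choose_one_right]
  rw [pow_add q n, pow_succ (-(d * e) / q ^ 2)]
  generalize (-(d * e) / q ^ 2) ^ n = t
  generalize q ^ n = x at *
  have h5 : 1 - x * e ≠ 0 := by rwa [mul_comm]
  field_simp

/-- A `q`-Zeilberger certificate: the first-order recurrence in `j` expected of the closed form
holds for the summand up to a difference in `k`. Dividing by the common reciprocal factorials and
using `baileyCoeff_succ` reduces it to a rational identity in `q^j` and `q^k`. -/
theorem unit_bailey_telescope {q d e : ℂ} (hq : q ≠ 0) (hq1 : ‖q‖ < 1) (hd0 : d ≠ 0)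
    (he0 : e ≠ 0) (hd : ∀ i : ℕ, d * q ^ i ≠ 1) (he : ∀ i : ℕ, e * q ^ i ≠ 1) (j k : ℕ)
    (g : ℕ → ℂ) (hg : ∀ k : ℕ, g k = -(q * q ^ j) * ((1 - q ^ k) / q ^ k) *
      ((1 - d * q ^ k / q) * (1 - e * q ^ k / q)) * baileyCoeff q d e k *
      (invQFac q (j + 1 - k) * invQFac q (j + k + 1))) :
    (1 - q * q ^ j) * (1 - d * q ^ j) * (1 - e * q ^ j) *
        ((1 - q * (q ^ k) ^ 2) * baileyCoeff q d e k *
          (invQFac q (j + 1 - k) * invQFac q (j + k + 2))) -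
      (1 - d * e / q ^ 2 * q ^ j) *
        ((1 - q * (q ^ k) ^ 2) * baileyCoeff q d e k *
          (invQFac q (j - k) * invQFac q (j + k + 1))) = g (k + 1) - g k := by
  have e1 : invQFac q (j - k) = (1 - q ^ j * q / q ^ k) * invQFac q (j + 1 - k) := by
    have := invQFac_sub_one hq hq1 (j + 1 - k)
    rwa [show (j : ℤ) + 1 - k - 1 = j - k by ring, zpow_sub₀ hq, zpow_add_one₀ hq, zpow_natCast,
      zpow_natCast] at this
  have e2 : invQFac q (j + k + 1) = (1 - q ^ j * q ^ k * q ^ 2) * invQFac q (j + k + 2) := by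
    have := invQFac_sub_one hq hq1 (j + k + 2)
    rwa [show (j : ℤ) + k + 2 - 1 = j + k + 1 by ring, zpow_add₀ hq, zpow_add₀ hq, zpow_natCast,
      zpow_natCast, zpow_ofNat] at this
  have e3 := baileyCoeff_succ hq hd0 he0 hd he k
  have e4 : g (k + 1) = -(q * q ^ j) * ((1 - q ^ k * q) / (q ^ k * q)) *
      ((1 - d * q ^ k) * (1 - e * q ^ k) * baileyCoeff q d e (k + 1)) *
      (invQFac q (j - k) * invQFac q (j + k + 2)) := by
    rw [hg]
    push_cast
    rw [show (j : ℤ) + 1 - (k + 1) = j - k by ring, show (j : ℤ) + (k + 1) + 1 = j + k + 2 by ring,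
      pow_succ]
    field_simp
  rw [e4, e3, hg k, e2, e1]
  have hx : q ^ k ≠ 0 := pow_ne_zero k hq
  generalize q ^ k = x at *
  generalize q ^ j = y at *
  generalize invQFac q (j + 1 - k) = X
  generalize invQFac q (j + k + 2) = Y
  generalize baileyCoeff q d e k = Z
  field_simp
  ring

/-- The unit Bailey pair relative to `a = q`: a terminating very-well-poised `₆φ₅` sum. -/
theorem sum_unit_bailey {q d e : ℂ} (hq : q ≠ 0) (hq1 : ‖q‖ < 1) (hd0 : d ≠ 0)
    (he0 : e ≠ 0) (hd : ∀ i : ℕ, d * q ^ i ≠ 1) (he : ∀ i : ℕ, e * q ^ i ≠ 1) (j : ℕ) :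
    ∑ k ∈ Finset.range (j + 1), (1 - q * (q ^ k) ^ 2) * baileyCoeff q d e k *
        (invQFac q (j - k) * invQFac q (j + k + 1)) =
      qFin q (d * e / q ^ 2) j / (qFin q q j * qFin q d j * qFin q e j) := by
  induction j with
  | zero =>
    have h1 := invQFac_natCast q 0
    have h2 := invQFac_natCast q 1
    have h3 : 1 - q ≠ 0 := by
      simpa using sub_ne_zero.2 (mul_pow_ne_one_of_norm_lt hq1 hq1 0).symm
    simp only [Nat.cast_zero, Nat.cast_one, qFin_succ, qFin_zero] at h1 h2
    simp [baileyCoeff, h1, h2, h3]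
  | succ j ih =>
    have h1 : 1 - q * q ^ j ≠ 0 := sub_ne_zero.2 (mul_pow_ne_one_of_norm_lt hq1 hq1 j).symm
    have h2 : 1 - d * q ^ j ≠ 0 := sub_ne_zero.2 (hd j).symm
    have h3 : 1 - e * q ^ j ≠ 0 := sub_ne_zero.2 (he j).symm
    -- The certificate is kept opaque so that the telescoping sum is recognised. Its end values
    -- vanish: `1 - q^0 = 0` at `k = 0`, and `1/(q)_{-1} = 0` at `k = j + 2`.
    obtain ⟨g, hg⟩ : ∃ g : ℕ → ℂ, ∀ k : ℕ, g k = -(q * q ^ j) * ((1 - q ^ k) / q ^ k) *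
      ((1 - d * q ^ k / q) * (1 - e * q ^ k / q)) * baileyCoeff q d e k *
      (invQFac q (j + 1 - k) * invQFac q (j + k + 1)) := ⟨_, fun _ => rfl⟩
    have z1 : invQFac q ((j : ℤ) + 1 - (j + 2 : ℕ)) = 0 := invQFac_of_neg hq (by push_cast; omega)
    have z2 : invQFac q ((j : ℤ) - (j + 1 : ℕ)) = 0 := invQFac_of_neg hq (by push_cast; omega)
    have key := Finset.sum_congr (rfl : Finset.range (j + 2) = _) fun k _ =>
      unit_bailey_telescope hq hq1 hd0 he0 hd he j k g hg
    rw [Finset.sum_range_sub, Finset.sum_sub_distrib, ← Finset.mul_sum, ← Finset.mul_sum,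
      hg, hg, z1, sub_eq_iff_eq_add, Finset.sum_range_succ (n := j + 1) (f := fun k =>
        (1 - q * (q ^ k) ^ 2) * baileyCoeff q d e k *
        (invQFac q (j - k) * invQFac q (j + k + 1))), ih, z2] at key
    simp only [pow_zero, sub_self, zero_div, mul_zero, zero_mul, add_zero, zero_add] at key
    have e1 : ∀ k : ℕ, ((j + 1 : ℕ) : ℤ) + k + 1 = j + k + 2 := fun k => by push_cast; ring
    simp only [e1]
    push_cast at key ⊢
    simp only [qFin_succ]
    have hQ := qFin_ne_zero (mul_pow_ne_one_of_norm_lt hq1 hq1) j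
    have hD := qFin_ne_zero hd j
    have hE := qFin_ne_zero he j
    have h123 := mul_ne_zero (mul_ne_zero h1 h2) h3
    refine mul_left_cancel₀ h123 (key.trans ?_)
    field_simp

/-! ### Absolute convergence and the exchange of summations. -/

/-- The quadratic exponent beats any geometric growth, so `t` is unrestricted. -/
theorem summable_mul_pow_mul_pow_choose {q : ℂ} (hq1 : ‖q‖ < 1) (t : ℂ) {f : ℕ → ℂ}
    {C : ℝ} (hf : ∀ n, ‖f n‖ ≤ C) :
    Summable fun n : ℕ => ‖f n * t ^ n * q ^ n.choose 2‖ := by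
  have h : Summable fun n : ℕ => t ^ n * q ^ n.choose 2 := by
    refine summable_of_ratio_norm_eventually_le (r := 1 / 2) (by norm_num) ?_
    have : Tendsto (fun n : ℕ => ‖t * q ^ n‖) atTop (𝓝 0) := by
      simpa using ((tendsto_pow_atTop_nhds_zero_of_norm_lt_one hq1).const_mul t).norm
    filter_upwards [this.eventually_le_const (by norm_num : (0 : ℝ) < 1 / 2)] with n hn
    have e : t ^ (n + 1) * q ^ (n + 1).choose 2 = t * q ^ n * (t ^ n * q ^ n.choose 2) := by
      rw [Nat.choose_succ_succ n 1, Nat.choose_one_right]; ring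
    rw [e, norm_mul]
    gcongr
  refine Summable.of_nonneg_of_le (fun _ => norm_nonneg _) (fun n => ?_) (h.norm.mul_left C)
  rw [mul_assoc, norm_mul]
  exact mul_le_mul_of_nonneg_right (hf n) (norm_nonneg _)

theorem exists_norm_baileyCoeff_ratio_le {q d : ℂ} (hq1 : ‖q‖ < 1)
    (a : ℂ) (hd : ∀ i : ℕ, d * q ^ i ≠ 1) :
    ∃ C, 0 ≤ C ∧ ∀ n, ‖qFin q a n / qFin q d n‖ ≤ C := by
  obtain ⟨C1, h1, H1⟩ := exists_norm_qFin_le hq1 a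
  obtain ⟨C2, h2, H2⟩ := exists_norm_inv_qFin_le hq1 hd
  refine ⟨C1 * C2, by positivity, fun n => ?_⟩
  rw [div_eq_mul_inv, norm_mul]
  exact mul_le_mul (H1 n) (H2 n) (norm_nonneg _) h1

theorem summable_mul_pow_mul_baileyCoeff {q d e : ℂ} (hq1 : ‖q‖ < 1)
    (hd : ∀ i : ℕ, d * q ^ i ≠ 1) (he : ∀ i : ℕ, e * q ^ i ≠ 1) (t : ℂ) {f : ℕ → ℂ}
    {C : ℝ} (hf : ∀ n, ‖f n‖ ≤ C) :
    Summable fun n : ℕ => ‖f n * t ^ n * baileyCoeff q d e n‖ := by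
  obtain ⟨C1, h1, H1⟩ := exists_norm_baileyCoeff_ratio_le hq1 (q ^ 2 / d) hd
  obtain ⟨C2, h2, H2⟩ := exists_norm_baileyCoeff_ratio_le hq1 (q ^ 2 / e) he
  refine (summable_mul_pow_mul_pow_choose hq1 (t * (-(d * e) / q ^ 2)) (C := C * C1 * C2)
    (f := fun n => f n * (qFin q (q ^ 2 / d) n / qFin q d n) *
      (qFin q (q ^ 2 / e) n / qFin q e n)) fun n => ?_).congr fun n => ?_
  · rw [norm_mul, norm_mul]
    have h0 := (norm_nonneg _).trans (hf 0)
    gcongr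
    exacts [hf n, H1 n, H2 n]
  · congr 1
    rw [baileyCoeff, mul_pow]
    simp only [div_eq_mul_inv, mul_inv]
    ring

/-- The reciprocal factorials are bounded uniformly in both indices, so the double series is
dominated by a geometric series in `w` times a convergent series in `n`. -/
theorem summable_bailey_double {q d e β γ w : ℂ} (hq : q ≠ 0) (hq1 : ‖q‖ < 1)
    (hd : ∀ i : ℕ, d * q ^ i ≠ 1) (he : ∀ i : ℕ, e * q ^ i ≠ 1) (hw : ‖w‖ < 1) :
    Summable fun p : ℕ × ℕ => qFin q β p.1 * qFin q γ p.1 * w ^ p.1 *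
      ((1 - q * (q ^ p.2) ^ 2) * baileyCoeff q d e p.2 *
        (invQFac q (p.1 - p.2) * invQFac q (p.1 + p.2 + 1))) := by
  obtain ⟨C1, h1, H1⟩ := exists_norm_qFin_le hq1 β
  obtain ⟨C2, h2, H2⟩ := exists_norm_qFin_le hq1 γ
  obtain ⟨C3, h3, H3⟩ := exists_norm_invQFac_le hq hq1
  have hC : ∀ n : ℕ, ‖1 - q * (q ^ n) ^ 2‖ ≤ 2 := fun n => by
    refine (norm_sub_le _ _).trans ?_
    have h := norm_mul_pow_lt_one hq1 hq1 (n * 2)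
    rw [pow_mul] at h
    rw [norm_one]; linarith
  have hs := summable_mul_pow_mul_baileyCoeff hq1 hd he 1 hC
  have hg := (summable_geometric_of_lt_one (norm_nonneg w) hw).mul_left (C1 * C2 * (C3 * C3))
  refine Summable.of_norm_bounded (hg.mul_of_nonneg hs (fun _ => by positivity)
    fun _ => norm_nonneg _) fun p => ?_
  simp only [norm_mul, norm_pow, one_pow, mul_one]
  calc _ = ‖qFin q β p.1‖ * ‖qFin q γ p.1‖ * (‖invQFac q (p.1 - p.2)‖ *
        ‖invQFac q (p.1 + p.2 + 1)‖) * ‖w‖ ^ p.1 *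
        (‖1 - q * (q ^ p.2) ^ 2‖ * ‖baileyCoeff q d e p.2‖) := by ring
    _ ≤ _ := by
      gcongr
      exacts [H1 _, H2 _, H3 _, H3 _]

/-- The Bailey transform for the unit Bailey pair. -/
theorem bailey_transform {q d e β γ w : ℂ} (hq : q ≠ 0) (hq1 : ‖q‖ < 1) (hd0 : d ≠ 0)
    (he0 : e ≠ 0) (hd : ∀ i : ℕ, d * q ^ i ≠ 1) (he : ∀ i : ℕ, e * q ^ i ≠ 1)
    (hw : ‖w‖ < 1) {S : ℕ → ℂ}
    (hS : ∀ n : ℕ, HasSum (fun j : ℕ => qFin q β j * qFin q γ j * w ^ j *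
      (invQFac q (j - n) * invQFac q (j + n + 1))) (S n)) :
    Summable (fun j : ℕ => qFin q β j * qFin q γ j * qFin q (d * e / q ^ 2) j /
      (qFin q q j * qFin q d j * qFin q e j) * w ^ j) ∧
    ∑' n : ℕ, (1 - q * (q ^ n) ^ 2) * baileyCoeff q d e n * S n =
      ∑' j : ℕ, qFin q β j * qFin q γ j * qFin q (d * e / q ^ 2) j /
        (qFin q q j * qFin q d j * qFin q e j) * w ^ j := by
  obtain ⟨f, hf⟩ : ∃ f : ℕ → ℕ → ℂ, ∀ j n : ℕ, f j n = qFin q β j * qFin q γ j * w ^ j *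
      ((1 - q * (q ^ n) ^ 2) * baileyCoeff q d e n *
        (invQFac q (j - n) * invQFac q (j + n + 1))) := ⟨_, fun _ _ => rfl⟩
  have hF : Summable (Function.uncurry f) :=
    (summable_bailey_double (β := β) (γ := γ) hq hq1 hd he hw).congr fun p => (hf p.1 p.2).symm
  have hin : ∀ j : ℕ, ∑' n : ℕ, f j n =
      qFin q β j * qFin q γ j * qFin q (d * e / q ^ 2) j /
        (qFin q q j * qFin q d j * qFin q e j) * w ^ j := fun j => by
    simp only [hf]
    rw [tsum_eq_sum (s := Finset.range (j + 1)), ← Finset.mul_sum,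
      sum_unit_bailey hq hq1 hd0 he0 hd he]
    · ring
    · intro n hn
      rw [Finset.mem_range] at hn
      rw [invQFac_of_neg hq (by omega)]; ring
  refine ⟨(summable_congr hin).1 hF.prod, ?_⟩
  rw [← tsum_congr hin, ← hF.tsum_comm]
  refine tsum_congr fun n => ?_
  rw [← (hS n).tsum_eq, ← tsum_mul_left]
  exact tsum_congr fun j => by rw [hf]; ring

/-! ### Folding the bilateral series. -/

theorem summable_and_tsum_int {f : ℤ → ℂ} (h1 : Summable fun n : ℕ => f (-(n : ℤ)))
    (h2 : Summable fun n : ℕ => f ((n : ℤ) + 1)) :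
    Summable f ∧ ∑' k : ℤ, f k = ∑' n : ℕ, (f (-(n : ℤ)) + f ((n : ℤ) + 1)) := by
  have h := HasSum.of_nat_of_neg_add_one (f := fun k : ℤ => f (-k)) h1.hasSum
    (by simpa only [neg_neg] using h2.hasSum)
  have h' : HasSum f _ := (Equiv.neg ℤ).hasSum_iff.1 h
  exact ⟨h'.summable, by rw [h'.tsum_eq, h1.tsum_add h2]⟩

theorem prod_one_sub_mul_inv_pow {q a : ℂ} (hq : q ≠ 0) (ha : a ≠ 0) (n : ℕ) :
    ∏ i ∈ Finset.range n, (1 - a * (q ^ (i + 1))⁻¹) =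
      ((-(q / a)) ^ n * q ^ n.choose 2 / qFin q (q / a) n)⁻¹ := by
  induction n with
  | zero => simp
  | succ n ih =>
    have hx : q ^ n ≠ 0 := pow_ne_zero n hq
    have e : 1 - a * (q ^ (n + 1))⁻¹ =
        (-(q / a))⁻¹ * (q ^ n)⁻¹ * (1 - q / a * q ^ n) := by
      rw [pow_succ]; field_simp; ring
    rw [Finset.prod_range_succ, ih, e, qFin_succ, Nat.choose_succ_succ n 1, Nat.choose_one_right,
      pow_succ (-(q / a)), pow_add]
    simp only [div_eq_mul_inv, mul_inv, inv_inv]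
    ring

/-- Also correct when `(q/a)_n = 0`: both sides are then `0` by the convention for division by zero.
-/
theorem qPoch_neg {q a : ℂ} (hq : q ≠ 0) (ha : a ≠ 0) (n : ℕ) :
    qPoch q a (-(n : ℤ)) = (-(q / a)) ^ n * q ^ n.choose 2 / qFin q (q / a) n := by
  rw [← inv_inv ((-(q / a)) ^ n * q ^ n.choose 2 / qFin q (q / a) n),
    ← prod_one_sub_mul_inv_pow hq ha]
  cases n with
  | zero => exact (qPoch_natCast q a 0).trans (by simp)
  | succ n => rfl

/-- The general term of the bilateral series with exponent `(k² - 5k)/2`. -/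
noncomputable def bilateralTerm (q b c d e : ℂ) (k : ℤ) : ℂ :=
  qPoch q (q / b) k * qPoch q (q / c) k * qPoch q (q / d) k * qPoch q (q / e) k /
    (qPoch q b k * qPoch q c k * qPoch q (d / q) k * qPoch q (e / q) k) *
    (-(b * c * d * e)) ^ k * q ^ ((k ^ 2 - 5 * k) / 2)

/-- The second series is the first one weighted by `u^k` with `u = q⁻¹`. -/
theorem bilateralTerm_mul_zpow_neg {q : ℂ} (hq : q ≠ 0) (b c d e : ℂ) (k : ℤ) :
    qPoch q (q / b) k * qPoch q (q / c) k * qPoch q (q / d) k * qPoch q (q / e) k /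
      (qPoch q b k * qPoch q c k * qPoch q (d / q) k * qPoch q (e / q) k) *
      (-(b * c * d * e)) ^ k * q ^ ((k ^ 2 - 7 * k) / 2) =
    bilateralTerm q b c d e k * q ^ (-k) := by
  rw [bilateralTerm, mul_assoc _ (q ^ ((k ^ 2 - 5 * k) / 2)), ← zpow_add₀ hq]
  congr 2
  rw [← Int.add_mul_ediv_right _ _ two_ne_zero]
  congr 1; ring

theorem natCast_choose_two (n : ℕ) : ((n.choose 2 : ℕ) : ℤ) = (n : ℤ) * (n - 1) / 2 := by
  rw [Nat.choose_two_right]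
  cases n with
  | zero => simp
  | succ n => push_cast; simp

/-- The well-poised factor `(q/b, q/c)_n / (b, c)_n (bc/q)^n`. -/
noncomputable def wellPoised (q b c : ℂ) (n : ℕ) : ℂ :=
  qFin q (q / b) n * qFin q (q / c) n / (qFin q b n * qFin q c n) * (b * c / q) ^ n

theorem bilateralTerm_neg {q b c d e : ℂ} (hq : q ≠ 0) (hb : b ≠ 0) (hc : c ≠ 0)
    (hd : d ≠ 0) (he : e ≠ 0) (n : ℕ) :
    bilateralTerm q b c d e (-(n : ℤ)) = wellPoised q b c n * baileyCoeff q d e n := by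
  have hexp : ((-(n : ℤ)) ^ 2 - 5 * -(n : ℤ)) / 2 = ((n.choose 2 + 3 * n : ℕ) : ℤ) := by
    push_cast
    rw [natCast_choose_two, ← Int.add_mul_ediv_right _ _ two_ne_zero]
    congr 1; ring
  have hpow : (-b) ^ n * (-c) ^ n * (-d) ^ n * (-e) ^ n /
      ((-(q / b)) ^ n * (-(q / c)) ^ n * (-(q ^ 2 / d)) ^ n * (-(q ^ 2 / e)) ^ n) *
      ((-(b * c * d * e)) ^ n)⁻¹ * (q ^ 3) ^ n = (b * c / q) ^ n * (-(d * e) / q ^ 2) ^ n := by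
    simp only [← mul_pow, ← div_pow, ← inv_pow]
    congr 1
    field_simp
  have hqn : q ^ n.choose 2 ≠ 0 := pow_ne_zero _ hq
  rw [bilateralTerm, hexp, zpow_natCast, zpow_neg, zpow_natCast, pow_add, pow_mul q 3,
    qPoch_neg hq (div_ne_zero hq hb), qPoch_neg hq (div_ne_zero hq hc),
    qPoch_neg hq (div_ne_zero hq hd), qPoch_neg hq (div_ne_zero hq he), qPoch_neg hq hb,
    qPoch_neg hq hc, qPoch_neg hq (div_ne_zero hd hq), qPoch_neg hq (div_ne_zero he hq),
    div_div_cancel₀ hq, div_div_cancel₀ hq, div_div_cancel₀ hq, div_div_cancel₀ hq,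
    show q / (d / q) = q ^ 2 / d by field_simp, show q / (e / q) = q ^ 2 / e by field_simp,
    wellPoised, baileyCoeff]
  -- The reflections contribute `q^(n choose 2)` four times above and four times below. These
  -- cancel, leaving the one from the quadratic exponent.
  calc _ = qFin q (q / b) n * qFin q (q / c) n / (qFin q b n * qFin q c n) *
        (qFin q (q ^ 2 / d) n * qFin q (q ^ 2 / e) n / (qFin q d n * qFin q e n)) *
        ((-b) ^ n * (-c) ^ n * (-d) ^ n * (-e) ^ n /
      ((-(q / b)) ^ n * (-(q / c)) ^ n * (-(q ^ 2 / d)) ^ n * (-(q ^ 2 / e)) ^ n) *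
      ((-(b * c * d * e)) ^ n)⁻¹ * (q ^ 3) ^ n) * q ^ n.choose 2 *
        (q ^ n.choose 2 * (q ^ n.choose 2)⁻¹) ^ 4 := by
        simp only [div_eq_mul_inv, mul_inv, inv_inv]; ring
    _ = _ := by rw [hpow, mul_inv_cancel₀ hqn]; ring

theorem bilateralTerm_succ {q b c d e : ℂ} (hq : q ≠ 0) (hd : d ≠ 0) (he : e ≠ 0)
    (hdq : 1 - d / q ≠ 0) (heq : 1 - e / q ≠ 0) (n : ℕ) :
    bilateralTerm q b c d e ((n : ℤ) + 1) =
      -(wellPoised q b c (n + 1) * (q * (q ^ n) ^ 2) * baileyCoeff q d e n) := by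
  have hexp : q ^ ((((n : ℤ) + 1) ^ 2 - 5 * ((n : ℤ) + 1)) / 2) =
      q ^ n.choose 2 * (q ^ n)⁻¹ * (q ^ 2)⁻¹ := by
    rw [← zpow_natCast, ← zpow_natCast, ← zpow_natCast, ← zpow_neg, ← zpow_neg,
      ← zpow_add₀ hq, ← zpow_add₀ hq]
    congr 1
    rw [natCast_choose_two, ← Int.add_mul_ediv_right _ _ two_ne_zero,
      ← Int.add_mul_ediv_right _ _ two_ne_zero]
    congr 1; push_cast; ring
  -- Splitting off the first factors, `(1 - q/x)/(1 - x/q) = -q/x`; this is where `d ≠ q` and `e ≠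
  -- q` enter.
  have e1 : ∀ x : ℂ, x ≠ 0 → 1 - x / q ≠ 0 →
      qFin q (q / x) (n + 1) / qFin q (x / q) (n + 1) =
      -(q / x) * (qFin q (q ^ 2 / x) n / qFin q x n) := fun x hx hxq => by
    rw [qFin_succ', qFin_succ', div_mul_cancel₀ _ hq, show q / x * q = q ^ 2 / x by ring,
      mul_div_mul_comm]
    congr 1
    rw [div_eq_iff hxq]
    field_simp; ring
  have hpow : (-(b * c * d * e)) ^ (n + 1) =
      -(d * e) * q * (b * c / q) ^ (n + 1) * ((-(d * e) / q ^ 2) ^ n * (q ^ n) ^ 3) := by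
    rw [← pow_mul q, mul_comm n 3, pow_mul q 3, ← mul_pow, pow_succ, pow_succ (b * c / q),
      show -(b * c * d * e) = b * c / q * (-(d * e) / q ^ 2 * q ^ 3) by field_simp,
      mul_pow (b * c / q)]
    field_simp
  have hqn : q ^ n ≠ 0 := pow_ne_zero _ hq
  rw [bilateralTerm, hexp, show (n : ℤ) + 1 = ((n + 1 : ℕ) : ℤ) by push_cast; ring]
  simp only [qPoch_natCast]
  rw [zpow_natCast, hpow]
  calc _ = qFin q (q / b) (n + 1) * qFin q (q / c) (n + 1) /
        (qFin q b (n + 1) * qFin q c (n + 1)) *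
        (qFin q (q / d) (n + 1) / qFin q (d / q) (n + 1)) *
        (qFin q (q / e) (n + 1) / qFin q (e / q) (n + 1)) *
        (-(d * e) * q * (b * c / q) ^ (n + 1) * ((-(d * e) / q ^ 2) ^ n * (q ^ n) ^ 3)) *
        (q ^ n.choose 2 * (q ^ n)⁻¹ * (q ^ 2)⁻¹) := by
        simp only [div_eq_mul_inv, mul_inv]; ring
    _ = _ := by
      rw [e1 d hd hdq, e1 e he heq, wellPoised, baileyCoeff]
      generalize (-(d * e) / q ^ 2) ^ n = s
      generalize (b * c / q) ^ (n + 1) = t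
      generalize q ^ n = x at *
      simp only [div_eq_mul_inv, mul_inv]
      field_simp

theorem summable_bilateral_halves {q b c d e : ℂ} (hq : q ≠ 0) (hq1 : ‖q‖ < 1)
    (hb0 : b ≠ 0) (hc0 : c ≠ 0) (hd0 : d ≠ 0) (he0 : e ≠ 0)
    (hb : ∀ j : ℕ, b * q ^ j ≠ 1) (hc : ∀ j : ℕ, c * q ^ j ≠ 1)
    (hd : ∀ j : ℕ, d * q ^ j ≠ 1) (he : ∀ j : ℕ, e * q ^ j ≠ 1)
    (hdq : 1 - d / q ≠ 0) (heq : 1 - e / q ≠ 0) (u : ℂ) :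
    (Summable fun n : ℕ => bilateralTerm q b c d e (-(n : ℤ)) * u ^ (-(n : ℤ))) ∧
      Summable fun n : ℕ => bilateralTerm q b c d e ((n : ℤ) + 1) * u ^ ((n : ℤ) + 1) := by
  obtain ⟨C1, h1, H1⟩ := exists_norm_baileyCoeff_ratio_le hq1 (q / b) hb
  obtain ⟨C2, h2, H2⟩ := exists_norm_baileyCoeff_ratio_le hq1 (q / c) hc
  have hbd : ∀ n, ‖qFin q (q / b) n * qFin q (q / c) n / (qFin q b n * qFin q c n)‖ ≤
      C1 * C2 := fun n => by
    rw [mul_div_mul_comm, norm_mul]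
    exact mul_le_mul (H1 n) (H2 n) (norm_nonneg _) h1
  constructor
  · refine (summable_mul_pow_mul_baileyCoeff hq1 hd he (b * c / q * u⁻¹) hbd).of_norm.congr
      fun n => ?_
    rw [bilateralTerm_neg hq hb0 hc0 hd0 he0, wellPoised, zpow_neg, zpow_natCast, mul_pow, inv_pow]
    ring
  · refine ((summable_mul_pow_mul_baileyCoeff hq1 hd he (b * c / q * q ^ 2 * u)
      fun n => hbd (n + 1)).of_norm.mul_left (-(b * c * u))).congr fun n => ?_
    rw [bilateralTerm_succ hq hd0 he0 hdq heq, wellPoised,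
      show (n : ℤ) + 1 = ((n + 1 : ℕ) : ℤ) by push_cast; ring, zpow_natCast, pow_succ u,
      mul_pow _ u, mul_pow _ (q ^ 2), pow_succ (b * c / q), ← pow_mul, ← pow_mul, mul_comm 2 n]
    generalize (b * c / q) ^ n = t
    field_simp

/-! ### `q`-Gauss expansions of the well-poised differences. -/

/-- With `x = q^n`, the core is `(1 - bx)(1 - cx) - (bc/q)(1 - qx/b)(1 - qx/c) = (1 - bc/q)(1 -
qx^2)`. -/
theorem wellPoised_sub_succ {q b c : ℂ} (hq : q ≠ 0) (hb0 : b ≠ 0) (hc0 : c ≠ 0)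
    (hb : ∀ j : ℕ, b * q ^ j ≠ 1) (hc : ∀ j : ℕ, c * q ^ j ≠ 1) (n : ℕ) :
    q ^ n * (wellPoised q b c n - wellPoised q b c (n + 1)) =
      (1 - b * c / q) * (1 - q * (q ^ n) ^ 2) * (qFin q (q / b) n * qFin q (q / c) n *
        (b * c) ^ n / (qFin q b (n + 1) * qFin q c (n + 1))) := by
  have h1 := qFin_ne_zero hb n
  have h2 := qFin_ne_zero hc n
  have h3 : 1 - b * q ^ n ≠ 0 := sub_ne_zero.2 (hb n).symm
  have h4 : 1 - c * q ^ n ≠ 0 := sub_ne_zero.2 (hc n).symm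
  have hx : q ^ n ≠ 0 := pow_ne_zero n hq
  simp only [wellPoised, qFin_succ, pow_succ (b * c / q)]
  rw [div_pow (b * c)]
  generalize q ^ n = x at *
  generalize (b * c) ^ n = t
  have h5 : 1 - x * c ≠ 0 := by rwa [mul_comm]
  have h6 : 1 - x * b ≠ 0 := by rwa [mul_comm]
  field_simp
  ring

/-- The prefactor `(q, bc/q)_∞ / (b, c)_∞`. -/
noncomputable def gaussFactor (q b c : ℂ) : ℂ :=
  qPochInf q q * qPochInf q (b * c / q) / (qPochInf q b * qPochInf q c)

/-- The `q`-Gauss expansion of the difference of well-poised factors, for `|bc| < |q|`. -/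
theorem exists_hasSum_wellPoised {q b c : ℂ} (hq : q ≠ 0) (hq1 : ‖q‖ < 1) (hb0 : b ≠ 0)
    (hc0 : c ≠ 0) (hb : ∀ j : ℕ, b * q ^ j ≠ 1) (hc : ∀ j : ℕ, c * q ^ j ≠ 1)
    (hw : ‖b * c / q‖ < 1) (n : ℕ) :
    ∃ S, HasSum (fun j : ℕ => qFin q (q / b) j * qFin q (q / c) j * (b * c / q) ^ j *
      (invQFac q (j - n) * invQFac q (j + n + 1))) S ∧
      wellPoised q b c n - q * (q ^ n) ^ 2 * wellPoised q b c (n + 1) =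
        gaussFactor q b c * ((1 - q * (q ^ n) ^ 2) * S) := by
  have hK : gaussFactor q b c ≠ 0 :=
    div_ne_zero (mul_ne_zero (qPochInf_ne_zero hq1 (mul_pow_ne_one_of_norm_lt hq1 hq1))
      (qPochInf_ne_zero hq1 (mul_pow_ne_one_of_norm_lt hq1 hw)))
      (mul_ne_zero (qPochInf_ne_zero hq1 hb) (qPochInf_ne_zero hq1 hc))
  have hx : 1 - q * (q ^ n) ^ 2 ≠ 0 := by
    have := mul_pow_ne_one_of_norm_lt hq1 hq1 (n * 2)
    rw [pow_mul] at this
    exact sub_ne_zero.2 this.symm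
  have hA : ∀ m : ℕ, HasSum (fun j : ℕ => qFin q (q / b) j * qFin q (q / c) j *
      (b * c / q) ^ j * (invQFac q (j - m) * invQFac q (j + m)))
      (wellPoised q b c m / gaussFactor q b c) := fun m => by
    have h := hasSum_conjugate_bailey hq hq1 hb0 hc0 0 m (by simpa using hw)
    simp only [pow_zero, mul_one, add_zero, Nat.cast_zero] at h
    convert h using 1
    rw [wellPoised, gaussFactor, qPochInf_eq_mul hq1 b m, qPochInf_eq_mul hq1 c m]
    have h1 := qFin_ne_zero hb m
    have h2 := qFin_ne_zero hc m
    field_simp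
  -- The witness combines the `s = 0` sums at `n` and `n + 1`. Termwise this rests on `(1 -
  -- q^(j+n+1)) - q^(2n+1) (1 - q^(j-n)) = 1 - q^(2n+1)`.
  refine ⟨(wellPoised q b c n / gaussFactor q b c - q * (q ^ n) ^ 2 *
    (wellPoised q b c (n + 1) / gaussFactor q b c)) / (1 - q * (q ^ n) ^ 2), ?_, ?_⟩
  · refine (((hA n).sub ((hA (n + 1)).mul_left (q * (q ^ n) ^ 2))).div_const _).congr_fun
      fun j => ?_
    have e1 := invQFac_sub_one hq hq1 (j + n + 1)
    have e2 := invQFac_sub_one hq hq1 (j - n)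
    rw [add_sub_cancel_right, zpow_add_one₀ hq, zpow_add₀ hq, zpow_natCast, zpow_natCast] at e1
    rw [zpow_sub₀ hq, zpow_natCast, zpow_natCast] at e2
    push_cast
    rw [← sub_sub, ← add_assoc, e1, e2, eq_div_iff hx]
    have hqn : q ^ n ≠ 0 := pow_ne_zero _ hq
    field_simp
    ring
  · field_simp

/-- The `q`-Gauss expansion of the difference of well-poised factors, for `|bc| < 1`. -/
theorem exists_hasSum_wellPoised' {q b c : ℂ} (hq : q ≠ 0) (hq1 : ‖q‖ < 1) (hb0 : b ≠ 0)
    (hc0 : c ≠ 0) (hb : ∀ j : ℕ, b * q ^ j ≠ 1) (hc : ∀ j : ℕ, c * q ^ j ≠ 1)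
    (hw : ‖b * c‖ < 1) (n : ℕ) :
    ∃ S, HasSum (fun j : ℕ => qFin q (q / b) j * qFin q (q / c) j * (b * c) ^ j *
      (invQFac q (j - n) * invQFac q (j + n + 1))) S ∧
      q ^ n * (wellPoised q b c n - wellPoised q b c (n + 1)) =
        gaussFactor q b c * ((1 - q * (q ^ n) ^ 2) * S) := by
  have hbc : b * c * q ^ 1 / q = b * c := by field_simp
  have h := hasSum_conjugate_bailey hq hq1 hb0 hc0 1 n (by rwa [hbc])
  rw [hbc] at h
  simp only [Nat.cast_one] at h
  refine ⟨_, h, ?_⟩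
  -- Here `bc = q` is allowed, so `gaussFactor` may vanish and cannot be divided by. The factor `1 -
  -- bc/q` is split off, since it occurs on both sides.
  have hI : qPochInf q (b * c / q) = (1 - b * c / q) * qPochInf q (b * c) := by
    rw [qPochInf_eq_mul hq1 _ 1, pow_one, div_mul_cancel₀ _ hq]; simp [qFin]
  have hbI := qPochInf_ne_zero hq1 hb
  have hcI := qPochInf_ne_zero hq1 hc
  have hqI := qPochInf_ne_zero hq1 (mul_pow_ne_one_of_norm_lt hq1 hq1)
  have hwI := qPochInf_ne_zero hq1 (mul_pow_ne_one_of_norm_lt hq1 hw)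
  rw [qPochInf_eq_mul hq1 b (n + 1)] at hbI
  rw [qPochInf_eq_mul hq1 c (n + 1)] at hcI
  rw [wellPoised_sub_succ hq hb0 hc0 hb hc, gaussFactor, hI, qPochInf_eq_mul hq1 b (n + 1),
    qPochInf_eq_mul hq1 c (n + 1)]
  have h1 := left_ne_zero_of_mul hbI
  have h2 := right_ne_zero_of_mul hbI
  have h3 := left_ne_zero_of_mul hcI
  have h4 := right_ne_zero_of_mul hcI
  generalize 1 - b * c / q = s
  field_simp

/-! ### Assembling the two identities. -/

theorem bilateral_identity {q b c d e w u : ℂ} (hq : q ≠ 0) (hq1 : ‖q‖ < 1)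
    (hb0 : b ≠ 0) (hc0 : c ≠ 0) (hd0 : d ≠ 0) (he0 : e ≠ 0)
    (hb : ∀ j : ℕ, b * q ^ j ≠ 1) (hc : ∀ j : ℕ, c * q ^ j ≠ 1)
    (hd : ∀ j : ℕ, d / q * q ^ j ≠ 1) (he : ∀ j : ℕ, e / q * q ^ j ≠ 1) (hw : ‖w‖ < 1)
    (hS : ∀ n : ℕ, ∃ S, HasSum (fun j : ℕ => qFin q (q / b) j * qFin q (q / c) j * w ^ j *
      (invQFac q (j - n) * invQFac q (j + n + 1))) S ∧
      wellPoised q b c n * u ^ (-(n : ℤ)) -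
        q * (q ^ n) ^ 2 * wellPoised q b c (n + 1) * u ^ ((n : ℤ) + 1) =
        gaussFactor q b c * ((1 - q * (q ^ n) ^ 2) * S)) :
    (Summable fun k : ℤ => bilateralTerm q b c d e k * u ^ k) ∧
    Summable (fun k : ℕ =>
      qPoch q (q / b) k * qPoch q (q / c) k * qPoch q (d * e / q ^ 2) k /
        (qPoch q q k * qPoch q d k * qPoch q e k) * w ^ k) ∧
    ∑' k : ℤ, bilateralTerm q b c d e k * u ^ k =
      qPochInf q q * qPochInf q (b * c / q) / (qPochInf q b * qPochInf q c) *
        ∑' k : ℕ, qPoch q (q / b) k * qPoch q (q / c) k * qPoch q (d * e / q ^ 2) k /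
          (qPoch q q k * qPoch q d k * qPoch q e k) * w ^ k := by
  have shift : ∀ x : ℂ, (∀ j : ℕ, x / q * q ^ j ≠ 1) → ∀ j : ℕ, x * q ^ j ≠ 1 := fun x hx j => by
    have := hx (j + 1)
    rwa [pow_succ', ← mul_assoc, div_mul_cancel₀ _ hq] at this
  have hdq : 1 - d / q ≠ 0 := by simpa using sub_ne_zero.2 (hd 0).symm
  have heq : 1 - e / q ≠ 0 := by simpa using sub_ne_zero.2 (he 0).symm
  choose S hS1 hS2 using hS
  obtain ⟨t1, t2⟩ := bailey_transform hq hq1 hd0 he0 (shift d hd) (shift e he) hw hS1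
  obtain ⟨h1, h2⟩ := summable_bilateral_halves hq hq1 hb0 hc0 hd0 he0 hb hc (shift d hd)
    (shift e he) hdq heq u
  obtain ⟨s1, s2⟩ := summable_and_tsum_int (f := fun k => bilateralTerm q b c d e k * u ^ k) h1 h2
  refine ⟨s1, t1, ?_⟩
  simp only [qPoch_natCast]
  rw [s2, ← t2, ← gaussFactor, ← tsum_mul_left]
  refine tsum_congr fun n => ?_
  rw [bilateralTerm_neg hq hb0 hc0 hd0 he0, bilateralTerm_succ hq hd0 he0 hdq heq]
  linear_combination baileyCoeff q d e n * hS2 n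

theorem corollary5p2 (q b c d e : ℂ) (hq0 : 0 < ‖q‖) (hq1 : ‖q‖ < 1)
    (hb0 : b ≠ 0) (hc0 : c ≠ 0) (hd0 : d ≠ 0) (he0 : e ≠ 0)
    -- no factor of `(b)_k`, `(c)_k`, `(d/q)_k`, `(e/q)_k` with `k ≥ 0` vanishes
    (hb : ∀ j : ℕ, b * q ^ j ≠ 1) (hc : ∀ j : ℕ, c * q ^ j ≠ 1)
    (hd : ∀ j : ℕ, d / q * q ^ j ≠ 1) (he : ∀ j : ℕ, e / q * q ^ j ≠ 1) :
    -- both exponents are integers, since `k² - 5k` and `k² - 7k` are even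
    (‖b * c‖ < ‖q‖ →
      Summable (fun k : ℤ =>
        qPoch q (q / b) k * qPoch q (q / c) k * qPoch q (q / d) k * qPoch q (q / e) k /
          (qPoch q b k * qPoch q c k * qPoch q (d / q) k * qPoch q (e / q) k) *
          (-(b * c * d * e)) ^ k * q ^ ((k ^ 2 - 5 * k) / 2)) ∧
      Summable (fun k : ℕ =>
        qPoch q (q / b) k * qPoch q (q / c) k * qPoch q (d * e / q ^ 2) k /
          (qPoch q q k * qPoch q d k * qPoch q e k) * (b * c / q) ^ k) ∧
      ∑' k : ℤ,
        qPoch q (q / b) k * qPoch q (q / c) k * qPoch q (q / d) k * qPoch q (q / e) k /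
          (qPoch q b k * qPoch q c k * qPoch q (d / q) k * qPoch q (e / q) k) *
          (-(b * c * d * e)) ^ k * q ^ ((k ^ 2 - 5 * k) / 2) =
        qPochInf q q * qPochInf q (b * c / q) / (qPochInf q b * qPochInf q c) *
          ∑' k : ℕ,
            qPoch q (q / b) k * qPoch q (q / c) k * qPoch q (d * e / q ^ 2) k /
              (qPoch q q k * qPoch q d k * qPoch q e k) * (b * c / q) ^ k) ∧
    (‖b * c‖ < 1 →
      Summable (fun k : ℤ =>
        qPoch q (q / b) k * qPoch q (q / c) k * qPoch q (q / d) k * qPoch q (q / e) k /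
          (qPoch q b k * qPoch q c k * qPoch q (d / q) k * qPoch q (e / q) k) *
          (-(b * c * d * e)) ^ k * q ^ ((k ^ 2 - 7 * k) / 2)) ∧
      Summable (fun k : ℕ =>
        qPoch q (q / b) k * qPoch q (q / c) k * qPoch q (d * e / q ^ 2) k /
          (qPoch q q k * qPoch q d k * qPoch q e k) * (b * c) ^ k) ∧
      ∑' k : ℤ,
        qPoch q (q / b) k * qPoch q (q / c) k * qPoch q (q / d) k * qPoch q (q / e) k /
          (qPoch q b k * qPoch q c k * qPoch q (d / q) k * qPoch q (e / q) k) *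
          (-(b * c * d * e)) ^ k * q ^ ((k ^ 2 - 7 * k) / 2) =
        qPochInf q q * qPochInf q (b * c / q) / (qPochInf q b * qPochInf q c) *
          ∑' k : ℕ,
            qPoch q (q / b) k * qPoch q (q / c) k * qPoch q (d * e / q ^ 2) k /
              (qPoch q q k * qPoch q d k * qPoch q e k) * (b * c) ^ k) := by
  have hq : q ≠ 0 := norm_pos_iff.1 hq0
  constructor
  · intro h
    have hw : ‖b * c / q‖ < 1 := by rwa [norm_div, div_lt_one hq0]
    have := bilateral_identity (u := 1) hq hq1 hb0 hc0 hd0 he0 hb hc hd he hw fun n => by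
      simpa using exists_hasSum_wellPoised hq hq1 hb0 hc0 hb hc hw n
    simpa only [one_zpow, mul_one, bilateralTerm] using this
  · intro hw
    have := bilateral_identity (u := q⁻¹) hq hq1 hb0 hc0 hd0 he0 hb hc hd he hw fun n => by
      obtain ⟨S, h1, h2⟩ := exists_hasSum_wellPoised' hq hq1 hb0 hc0 hb hc hw n
      refine ⟨S, h1, h2 ▸ ?_⟩
      have hx : q ^ n ≠ 0 := pow_ne_zero n hq
      -- For `u = q⁻¹` the weights `u^(-n)` and `q^(2n+1) u^(n+1)` both equal `q^n`.
      rw [zpow_neg, zpow_add_one₀ (inv_ne_zero hq), zpow_natCast, inv_pow, inv_inv]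
      field_simp
    simpa only [bilateralTerm_mul_zpow_neg hq, inv_zpow'] using this
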